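/- Let $\mathbb F$ be a field with $\operatorname{char}\mathbb F\neq 2$. Algebras are finite-dimensional over a field and need be neither associative nor unital. A Malcev algebra is an algebra $A$ such that $xy=-yx$ and $(xy)(xz)=((xy)z)x+((yz)x)x+((zx)x)y$ for all $x,y,z\in A$. A Lie algebra is an algebra $A$ such that $xx=0$ and $(xy)z+(yz)x+(zx)y=0$ for all $x,y,z\in A$. For a finite subset $S$ of an algebra $A$ and an integer $i\ge 0$, let $L_i(S)$ be the linear span of all products, with arbitrary bracketing, of at least one and at most $i$ (not necessarily distinct) elements of $S$, together with the identity element of $A$ (as the word of length $0$) if $A$ has one. The set $S$ generates $A$ if $\bigcup_{i\ge 0}L_i(S)=A$; in that case its length $l(S)$ is the least $k\ge 0$ with $L_k(S)=A$. The length of $A$ is $l(A)=\max\{l(S) : S \text{ a finite generating set of } A\}$. A class of algebras has slowly growing length if $l(A)\le\dim A$ for every algebra $A$ in the class. Theorem. Let $A$ be a Malcev algebra over $\mathbb F$ of finite dimension $d$. (1) If $d\ge 2$, then $l(A)\le d-1$. (2) If $A$ is not a Lie algebra, then $l(A)\le d-2$. (3) Consequently, $l(A)\le d$ in all dimensions $d\ge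 0$; that is, the class of finite-dimensional Malcev algebras over fields of characteristic different from $2$ has slowly growing length. -/

import Mathlib

universe u v

namespace NonassocLength

section Words

variable (F : Type u) [Field F] {A : Type v} [NonUnitalNonAssocRing A] [Module F A]

/-- `e` is a two-sided identity element of `A`. -/
def IsIdentity (e : A) : Prop := ∀ x : A, e * x = x ∧ x * e = x

/-- The elements of `A` that are words of length at most `i` in `S`: values of bracketed products
of at most `i` letters from `S`, together with the identity element of `A`, if there is one, as the
word of length `0`. (An element `w` of `FreeMagma S` is a bracketed product of letters from `S`,
`w.length` is its number of letters, which is at least `1`, and `FreeMagma.lift` evaluates it.) -/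
def words (S : Set A) (i : ℕ) : Set A :=
  {a | ∃ w : FreeMagma S, w.length ≤ i ∧ FreeMagma.lift (Subtype.val : S → A) w = a} ∪
    {e | IsIdentity e}

/-- `L_i(S)`, the linear span of the words of length at most `i` in `S`. -/
def wordSpan (S : Set A) (i : ℕ) : Submodule F A := Submodule.span F (words S i)

/-- `S` generates `A`: the union of the subspaces `L_i(S)` is all of `A`. -/
def Generates (S : Set A) : Prop := ∀ a : A, ∃ i : ℕ, a ∈ wordSpan F S i

/-- The length of `S`: the least `k` with `L_k(S) = A` (and `⊤` if there is no such `k`). -/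
noncomputable def setLength (S : Set A) : ℕ∞ :=
  ⨅ (k : ℕ) (_ : wordSpan F S k = ⊤), (k : ℕ∞)

end Words

/-- The length of the algebra `A`: the supremum of the lengths of its finite generating sets. -/
noncomputable def length (F : Type u) [Field F] (A : Type v) [NonUnitalNonAssocRing A]
    [Module F A] : ℕ∞ :=
  ⨆ (S : Set A) (_ : S.Finite ∧ Generates F S), setLength F S

/-- Malcev algebras. -/
structure IsMalcev (A : Type v) [NonUnitalNonAssocRing A] : Prop where
  anticomm : ∀ x y : A, x * y = -(y * x)
  malcev : ∀ x y z : A,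
    (x * y) * (x * z) = ((x * y) * z) * x + ((y * z) * x) * x + ((z * x) * x) * y

/-- Lie algebras, with the bracket written as the multiplication. -/
structure IsLie (A : Type v) [NonUnitalNonAssocRing A] : Prop where
  mul_self : ∀ x : A, x * x = 0
  jacobi : ∀ x y z : A, (x * y) * z + (y * z) * x + (z * x) * y = 0

/-- A class `C` of (finite-dimensional, not necessarily unital or associative) algebras over fields
has slowly growing length if the length of each of its members is at most the dimension. -/
def HasSlowlyGrowingLength
    (C : ∀ (F : Type u) [Field F] (A : Type v) [NonUnitalNonAssocRing A] [Module F A], Prop) :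
    Prop :=
  ∀ (F : Type u) [Field F] (A : Type v) [NonUnitalNonAssocRing A] [Module F A]
    [IsScalarTower F A A] [SMulCommClass F A A] [FiniteDimensional F A],
    C F A → length F A ≤ (Module.finrank F A : ℕ∞)

/-- The class of Malcev algebras over fields of characteristic different from `2`. -/
def MalcevClass (F : Type u) [Field F] (A : Type v) [NonUnitalNonAssocRing A] [Module F A] :
    Prop :=
  ringChar F ≠ 2 ∧ IsMalcev A

end NonassocLength

namespace NonassocLength

/-! ### Sagle's identity and Jacobians -/

section Identities

variable {F : Type u} [Field F] {A : Type v} [NonUnitalNonAssocRing A] [Module F A]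

/-! Write `P_n` for the span of products of at most `n` generators and `m = dim P_1`. In operator
form, Sagle's identity rewrites right multiplication by a product of three factors through right
multiplications by shorter products. Hence `P_n` lies in `P_1 + P_(n-1) P_1 + P_(n-2) P_2`, and the
chain is constant from `k` on as soon as `P_(k+2) = P_k` with `k ≥ 1` (`IsMalcev.prodSpan_stable`).

The chain may still pause for one step. The key point (`IsMalcev.finrank_add_two_le`) is that a
pause at length `k + 1` that is not final is paid for in advance: the dimension grew by at least 2
at length `k`. So until it reaches `A`, the chain gains on average one dimension per step: `dim
P_(j+1) ≥ j + m`, and therefore `P_(d-m+1) = A`.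

It remains to bound `m` below. If `m ≤ 1`, all products vanish and `A = P_1`, so `d ≥ 2` forces `m ≥
2`. If `m ≤ 2`, then `A` is generated by two elements and is a Lie algebra
(`IsMalcev.isLie_of_pair`), so a non-Lie `A` has `m ≥ 3`. -/

theorem eq_zero_of_add_self (h2 : (2 : F) ≠ 0) {a : A} (h : a + a = 0) : a = 0 := by
  rw [← two_smul F] at h
  exact (smul_eq_zero.mp h).resolve_left h2

theorem mem_of_add_self_mem (h2 : (2 : F) ≠ 0) {V : Submodule F A} {a : A} (h : a + a ∈ V) :
    a ∈ V := by
  rw [← two_smul F] at h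
  exact (V.smul_mem_iff h2).mp h

theorem IsMalcev.mul_self (hA : IsMalcev A) (h2 : (2 : F) ≠ 0) (x : A) : x * x = 0 :=
  eq_zero_of_add_self h2 (by nth_rw 1 [hA.anticomm x x]; exact neg_add_cancel _)

/-- The Malcev identity linearized in `x`. -/
theorem IsMalcev.linearized (hA : IsMalcev A) (x t y z : A) :
    (x * y) * (t * z) + (t * y) * (x * z) =
      ((x * y) * z) * t + ((t * y) * z) * x + ((y * z) * x) * t + ((y * z) * t) * x +
        ((z * x) * t) * y + ((z * t) * x) * y := by
  have h := hA.malcev (x + t) y z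
  simp only [add_mul, mul_add, hA.malcev x y z, hA.malcev t y z] at h
  rw [← sub_eq_zero] at h ⊢
  rw [← h]
  abel

/-- Sagle's identity. -/
theorem IsMalcev.sagle (hA : IsMalcev A) (h2 : (2 : F) ≠ 0) (x z y t : A) :
    (x * z) * (y * t) =
      ((x * y) * z) * t + ((y * z) * t) * x + ((z * t) * x) * y + ((t * x) * y) * z := by
  have e1 := hA.linearized x y z t
  have e2 := hA.linearized x z t y
  have e3 := hA.linearized x t y z
  have key : ∀ a b c d : A, a * b * c * d = -(b * a * c * d) := fun a b c d => by
    rw [hA.anticomm a b, neg_mul, neg_mul]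
  have p1 : y * z * (x * t) = x * t * (z * y) := by
    rw [hA.anticomm, hA.anticomm y z, mul_neg, neg_neg]
  have p2 : z * t * (x * y) = x * y * (t * z) := by
    rw [hA.anticomm, hA.anticomm z t, mul_neg, neg_neg]
  have p3 : t * y * (x * z) = x * z * (y * t) := by
    rw [hA.anticomm, hA.anticomm t y, mul_neg, neg_neg]
  rw [p1] at e1
  rw [p2] at e2
  rw [p3] at e3
  simp only [key y x, key z x, key t x, key t y] at e1 e2 e3 ⊢
  rw [← sub_eq_zero] at e1 e2 e3 ⊢
  apply eq_zero_of_add_self h2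
  -- Each of the three products of pairs occurs in two of the linearizations; `e1 - e2 + e3` keeps
  -- only twice `(x * z) * (y * t)`.
  have := congrArg₂ (· + ·) (congrArg₂ (· - ·) e1 e2) e3
  simp only [add_zero, sub_zero] at this
  rw [← this]
  abel

/-- The operator form of Sagle's identity: multiplication by `(y * z) * t` is a combination of
iterated multiplications by shorter products of `y`, `z`, `t`. -/
theorem IsMalcev.mul_triple (hA : IsMalcev A) (h2 : (2 : F) ≠ 0) (u y z t : A) :
    u * ((y * z) * t) =
      ((u * y) * z) * t - ((u * t) * y) * z - (u * (z * t)) * y - (u * z) * (y * t) := by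
  rw [hA.sagle h2 u z y t, hA.anticomm u (y * z * t), hA.anticomm u (z * t), hA.anticomm u t]
  simp only [neg_mul]
  abel

/-- In the sum of the two Sagle expansions the terms ending in `w` cancel, as they contain `a * c`
and `c * a`. Every surviving term ends in a single `a`, `b` or `c`. -/
theorem IsMalcev.mul_mul_swap (hA : IsMalcev A) (h2 : (2 : F) ≠ 0) (w c a b : A) :
    (w * c) * (a * b) + (w * a) * (c * b) =
      (w * a * c + w * c * a) * b + (c * b * w + b * w * c) * a + (b * w * a + a * b * w) * c := by
  rw [hA.sagle h2 w c a b, hA.sagle h2 w a c b, hA.anticomm c a]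
  simp only [add_mul, neg_mul]
  abel

/-- Two Sagle expansions combined so that the terms ending in `w` cancel. Used with `p` a product of
two generators: only the last two terms then fail to end in a generator. -/
theorem IsMalcev.mul_prod_add (hA : IsMalcev A) (h2 : (2 : F) ≠ 0) (w t s p : A) :
    (w * p) * (t * s) + (w * (t * s)) * p =
      (w * p * t + w * t * p) * s + (p * s * w + s * w * p) * t - (w * s * t) * p
        - (w * t) * (p * s) := by
  have e1 := hA.sagle h2 w t p s
  have e2 := hA.sagle h2 w p t s
  rw [eq_sub_iff_add_eq, e1, e2, hA.anticomm p t, hA.anticomm w (t * s), hA.anticomm w s]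
  simp only [add_mul, neg_mul]
  abel

/-- The Jacobian. -/
def jac (x y z : A) : A := (x * y) * z + (y * z) * x + (z * x) * y

theorem jac_rotate (x y z : A) : jac x y z = jac y z x := by
  unfold jac; abel

theorem IsMalcev.jac_swap (hA : IsMalcev A) (x y z : A) : jac x y z = -jac y x z := by
  unfold jac
  rw [hA.anticomm x y, hA.anticomm y z, hA.anticomm z x]
  simp only [neg_mul]
  abel

theorem IsMalcev.jac_swap_right (hA : IsMalcev A) (x y z : A) : jac x y z = -jac x z y := by
  rw [jac_rotate, hA.jac_swap, ← jac_rotate x z y]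

theorem IsMalcev.jac_self (hA : IsMalcev A) (h2 : (2 : F) ≠ 0) (x y : A) : jac x x y = 0 :=
  eq_zero_of_add_self h2 (by nth_rw 1 [hA.jac_swap]; exact neg_add_cancel _)

theorem IsMalcev.jac_mul_self (hA : IsMalcev A) (x y z : A) :
    jac x y (x * z) = jac x y z * x := by
  have h := hA.malcev x y z
  simp only [jac, add_mul]
  rw [h, hA.anticomm y (x * z), hA.anticomm x z]
  simp only [neg_mul, neg_neg]
  abel

/-- Linearization of `IsMalcev.jac_mul_self` in its repeated variable. -/
theorem IsMalcev.jac_mul (hA : IsMalcev A) (x y z w : A) :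
    jac x y (z * w) + jac z y (x * w) = jac x y w * z + jac z y w * x := by
  have h := hA.jac_mul_self (x + z) y w
  have hx := hA.jac_mul_self x y w
  have hz := hA.jac_mul_self z y w
  simp only [jac, mul_add, add_mul] at h hx hz ⊢
  rw [← sub_eq_zero] at h hx hz ⊢
  have := congrArg₂ (· - ·) (congrArg₂ (· - ·) h hx) hz
  simp only [sub_zero] at this
  rw [← this]
  abel

theorem IsMalcev.isLie_of_jac (hA : IsMalcev A) (h2 : (2 : F) ≠ 0)
    (h : ∀ x y z : A, jac x y z = 0) : IsLie A :=
  ⟨hA.mul_self h2, h⟩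

end Identities

/-! ### The filtration by product length, and reductions modulo products ending in a generator -/

section Filtration

variable (F : Type u) [Field F] {A : Type v} [NonUnitalNonAssocRing A] [Module F A]

/-- The span of the products of at least one and at most `n` elements of `S`. -/
def prodSpan (S : Set A) (n : ℕ) : Submodule F A :=
  Submodule.span F {a | ∃ w : FreeMagma S, w.length ≤ n ∧ FreeMagma.lift (Subtype.val : S → A) w = a}

variable {F} {S : Set A}

theorem lift_mem_prodSpan (w : FreeMagma S) {n : ℕ} (h : w.length ≤ n) :
    FreeMagma.lift (Subtype.val : S → A) w ∈ prodSpan F S n :=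
  Submodule.subset_span ⟨w, h, rfl⟩

theorem prodSpan_le {n : ℕ} {W : Submodule F A}
    (h : ∀ w : FreeMagma S, w.length ≤ n → FreeMagma.lift (Subtype.val : S → A) w ∈ W) :
    prodSpan F S n ≤ W := by
  refine Submodule.span_le.mpr ?_
  rintro _ ⟨w, hw, rfl⟩
  exact h w hw

theorem prodSpan_mono {m n : ℕ} (h : m ≤ n) : prodSpan F S m ≤ prodSpan F S n :=
  prodSpan_le fun w hw => lift_mem_prodSpan w (hw.trans h)

theorem subset_prodSpan {s : A} (hs : s ∈ S) {n : ℕ} (hn : 1 ≤ n) : s ∈ prodSpan F S n := by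
  have h := lift_mem_prodSpan (F := F) (FreeMagma.of (⟨s, hs⟩ : S)) (n := n) (by simpa using hn)
  simpa using h

theorem prodSpan_zero : prodSpan F S 0 = ⊥ :=
  eq_bot_iff.mpr (prodSpan_le fun w hw => absurd w.length_pos (by omega))

theorem prodSpan_one_le {W : Submodule F A} (h : S ⊆ W) : prodSpan F S 1 ≤ W := by
  refine prodSpan_le fun w hw => ?_
  cases w with
  | of s => simpa using h s.2
  | mul a b =>
    have := a.length_pos
    have := b.length_pos
    change a.length + b.length ≤ 1 at hw
    omega

theorem prodSpan_two_le {W : Submodule F A} (h : S ⊆ W) (hm : ∀ s ∈ S, ∀ t ∈ S, s * t ∈ W) :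
    prodSpan F S 2 ≤ W := by
  refine prodSpan_le fun w hw => ?_
  cases w with
  | of s => simpa using h s.2
  | mul a b =>
    have ha := a.length_pos
    have hb := b.length_pos
    change a.length + b.length ≤ 2 at hw
    change FreeMagma.lift _ (a * b) ∈ W
    rw [map_mul]
    cases a with
    | of s =>
      cases b with
      | of t => simpa using hm s s.2 t t.2
      | mul c d =>
        have := c.length_pos
        have := d.length_pos
        change 1 + (c.length + d.length) ≤ 2 at hw
        omega
    | mul c d =>
      have := c.length_pos
      have := d.length_pos
      change (c.length + d.length) + _ ≤ 2 at hw
      omega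

theorem mul_mem_prodSpan [IsScalarTower F A A] [SMulCommClass F A A] {m n : ℕ} {x y : A}
    (hx : x ∈ prodSpan F S m) (hy : y ∈ prodSpan F S n) : x * y ∈ prodSpan F S (m + n) := by
  have h1 : prodSpan F S m ≤ (prodSpan F S (m + n)).comap (LinearMap.mulRight F y) := by
    refine prodSpan_le fun w hw => ?_
    have h2 : prodSpan F S n ≤ (prodSpan F S (m + n)).comap
        (LinearMap.mulLeft F (FreeMagma.lift (Subtype.val : S → A) w)) := by
      refine prodSpan_le fun z hz => ?_
      rw [Submodule.mem_comap, LinearMap.mulLeft_apply, ← map_mul]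
      exact lift_mem_prodSpan _ (by change w.length + z.length ≤ _; omega)
    exact h2 hy
  exact h1 hx

theorem mul_mem_prodSpan_of_le [IsScalarTower F A A] [SMulCommClass F A A] {m n k : ℕ}
    (h : m + n ≤ k) {x y : A} (hx : x ∈ prodSpan F S m) (hy : y ∈ prodSpan F S n) :
    x * y ∈ prodSpan F S k :=
  prodSpan_mono h (mul_mem_prodSpan hx hy)

variable [IsScalarTower F A A] [SMulCommClass F A A]

/-- Induction on the length of the last factor: Sagle's identity moves letters from it into `u`,
without raising the total length, until it has length 1 or 2. -/
theorem IsMalcev.mul_lift_mem (hA : IsMalcev A) (h2 : (2 : F) ≠ 0) {n : ℕ} {W : Submodule F A}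
    (hl : ∀ u ∈ prodSpan F S (n - 1), ∀ g ∈ prodSpan F S 1, u * g ∈ W)
    (hq : ∀ u ∈ prodSpan F S (n - 2), ∀ q ∈ prodSpan F S 2, u * q ∈ W) (l : ℕ) :
    ∀ w : FreeMagma S, w.length ≤ l → ∀ p, p + w.length ≤ n → ∀ u ∈ prodSpan F S p,
      u * FreeMagma.lift (Subtype.val : S → A) w ∈ W := by
  induction l with
  | zero => exact fun w hw => absurd w.length_pos (by omega)
  | succ l ih =>
    have triple : ∀ y z t : FreeMagma S, y.length + z.length + t.length ≤ l + 1 →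
        ∀ p, p + (y.length + z.length + t.length) ≤ n → ∀ u ∈ prodSpan F S p,
        u * FreeMagma.lift (Subtype.val : S → A) (y * z * t) ∈ W := by
      intro y z t hl p hp u hu
      have hy := y.length_pos
      have hz := z.length_pos
      have ht := t.length_pos
      have my := lift_mem_prodSpan (F := F) y le_rfl
      have mz := lift_mem_prodSpan (F := F) z le_rfl
      have mt := lift_mem_prodSpan (F := F) t le_rfl
      rw [map_mul, map_mul, hA.mul_triple h2]
      refine W.sub_mem (W.sub_mem (W.sub_mem ?_ ?_) ?_) ?_
      · exact ih t (by omega) _ (by omega) _ (mul_mem_prodSpan (mul_mem_prodSpan hu my) mz)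
      · exact ih z (by omega) _ (by omega) _ (mul_mem_prodSpan (mul_mem_prodSpan hu mt) my)
      · exact ih y (by omega) _ (by omega) _ (mul_mem_prodSpan hu (mul_mem_prodSpan mz mt))
      · rw [← map_mul (FreeMagma.lift _) y t]
        exact ih (y * t) (by change y.length + t.length ≤ l; omega) _
          (by change _ + (y.length + t.length) ≤ n; omega) _ (mul_mem_prodSpan hu mz)
    intro w hw p hp u hu
    cases w with
    | of s =>
      change p + 1 ≤ n at hp
      exact hl u (prodSpan_mono (by omega) hu) _ (lift_mem_prodSpan _ le_rfl)
    | mul a b =>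
      change a.length + b.length ≤ l + 1 at hw
      change p + (a.length + b.length) ≤ n at hp
      change u * FreeMagma.lift _ (a * b) ∈ W
      cases a with
      | mul y z => exact triple y z b hw p hp u hu
      | of s =>
        cases b with
        | of t =>
          change p + 2 ≤ n at hp
          exact hq u (prodSpan_mono (by omega) hu) _ (lift_mem_prodSpan _ le_rfl)
        | mul y z =>
          change 1 + (y.length + z.length) ≤ l + 1 at hw
          change p + (1 + (y.length + z.length)) ≤ n at hp
          have h := triple y z (FreeMagma.of s) (by change _ + 1 ≤ _; omega) p
            (by change p + (_ + 1) ≤ _; omega) u hu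
          rw [map_mul, hA.anticomm (FreeMagma.lift _ (y * z)), mul_neg] at h
          rw [map_mul]
          exact W.neg_mem_iff.mp h

/-- In a Malcev algebra the products of length `n` are generated by those whose last factor has
length at most `2`. -/
theorem IsMalcev.prodSpan_le_of_mul_mem (hA : IsMalcev A) (h2 : (2 : F) ≠ 0) {n : ℕ}
    {W : Submodule F A} (h1 : prodSpan F S 1 ≤ W)
    (hl : ∀ u ∈ prodSpan F S (n - 1), ∀ g ∈ prodSpan F S 1, u * g ∈ W)
    (hq : ∀ u ∈ prodSpan F S (n - 2), ∀ q ∈ prodSpan F S 2, u * q ∈ W) :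
    prodSpan F S n ≤ W := by
  refine prodSpan_le fun w hw => ?_
  cases w with
  | of s => exact h1 (lift_mem_prodSpan _ le_rfl)
  | mul a b =>
    change FreeMagma.lift _ (a * b) ∈ W
    rw [map_mul]
    exact hA.mul_lift_mem h2 hl hq _ b le_rfl a.length hw _ (lift_mem_prodSpan _ le_rfl)

/-- Modulo products with last factor in `S`, the product `(w * c) * (a * b)` with `a, b, c` in the
span of `S` is skew-symmetric in `a` and `c`. -/
theorem IsMalcev.mul_mul_add_swap_mem (hA : IsMalcev A) (h2 : (2 : F) ≠ 0) {n : ℕ}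
    {W : Submodule F A} (hl : ∀ u ∈ prodSpan F S (n - 1), ∀ g ∈ prodSpan F S 1, u * g ∈ W)
    {p : ℕ} (hp : p + 3 ≤ n) {w a b c : A} (hw : w ∈ prodSpan F S p) (ha : a ∈ prodSpan F S 1)
    (hb : b ∈ prodSpan F S 1) (hc : c ∈ prodSpan F S 1) :
    (w * c) * (a * b) + (w * a) * (c * b) ∈ W := by
  have right : ∀ {x y}, x ∈ prodSpan F S 1 → y ∈ prodSpan F S 1 →
      w * x * y ∈ prodSpan F S (n - 1) := fun hx hy =>
    prodSpan_mono (by omega) (mul_mem_prodSpan (mul_mem_prodSpan hw hx) hy)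
  have left : ∀ {x y}, x ∈ prodSpan F S 1 → y ∈ prodSpan F S 1 →
      x * y * w ∈ prodSpan F S (n - 1) := fun hx hy =>
    prodSpan_mono (by omega) (mul_mem_prodSpan (mul_mem_prodSpan hx hy) hw)
  have mid : ∀ {x y}, x ∈ prodSpan F S 1 → y ∈ prodSpan F S 1 →
      x * w * y ∈ prodSpan F S (n - 1) := fun hx hy =>
    prodSpan_mono (by omega) (mul_mem_prodSpan (mul_mem_prodSpan hx hw) hy)
  rw [hA.mul_mul_swap h2]
  exact W.add_mem (W.add_mem
    (hl _ (add_mem (right ha hc) (right hc ha)) _ hb)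
    (hl _ (add_mem (left hc hb) (mid hb hc)) _ ha))
    (hl _ (add_mem (mid hb ha) (left ha hb)) _ hc)

/-- Modulo products with last factor in `S`, multiplications by two products of length `2`
anticommute. -/
theorem IsMalcev.mul_prod_add_swap_mem (hA : IsMalcev A) (h2 : (2 : F) ≠ 0) {n : ℕ}
    {W : Submodule F A} (hl : ∀ u ∈ prodSpan F S (n - 1), ∀ g ∈ prodSpan F S 1, u * g ∈ W)
    {p : ℕ} (hp : p + 4 ≤ n) {w y z t s : A} (hw : w ∈ prodSpan F S p) (hy : y ∈ prodSpan F S 1)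
    (hz : z ∈ prodSpan F S 1) (ht : t ∈ prodSpan F S 1) (hs : s ∈ prodSpan F S 1) :
    (w * (y * z)) * (t * s) + (w * (t * s)) * (y * z) ∈ W := by
  have key : ∀ {t s}, t ∈ prodSpan F S 1 → s ∈ prodSpan F S 1 →
      (w * (y * z)) * (t * s) + (w * (t * s)) * (y * z) +
        (w * s * t + w * t * s) * (y * z) ∈ W := by
    intro t s ht hs
    have hwt := mul_mem_prodSpan hw ht
    have hws := mul_mem_prodSpan hw hs
    have hsw := mul_mem_prodSpan hs hw
    have hyz := mul_mem_prodSpan hy hz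
    have hwp := mul_mem_prodSpan hw hyz
    have e1 : (w * (y * z)) * (t * s) + (w * (t * s)) * (y * z) + (w * s * t) * (y * z) +
        (w * t) * ((y * z) * s) ∈ W := by
      rw [hA.mul_prod_add h2]
      have h1 := hl _ (prodSpan_mono (by omega)
        (add_mem (mul_mem_prodSpan hwp ht) (prodSpan_mono (by omega)
          (mul_mem_prodSpan hwt hyz)))) _ hs
      have h3 := hl _ (prodSpan_mono (by omega)
        (add_mem (mul_mem_prodSpan (mul_mem_prodSpan hyz hs) hw) (prodSpan_mono (by omega)
          (mul_mem_prodSpan hsw hyz)))) _ ht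
      convert W.add_mem h1 h3 using 1
      abel
    have e2 : (w * t) * ((y * z) * s) + ((w * t) * z) * (y * s) ∈ W := by
      rw [hA.mul_triple h2]
      have h1 := hl _ (prodSpan_mono (by omega)
        (mul_mem_prodSpan (mul_mem_prodSpan hwt hy) hz)) _ hs
      have h3 := hl _ (prodSpan_mono (by omega)
        (mul_mem_prodSpan (mul_mem_prodSpan hwt hs) hy)) _ hz
      have h4 := hl _ (prodSpan_mono (by omega)
        (mul_mem_prodSpan hwt (mul_mem_prodSpan hz hs))) _ hy
      convert W.sub_mem (W.sub_mem h1 h3) h4 using 1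
      abel
    have e3 := hA.mul_mul_add_swap_mem h2 hl (by omega) hwt hs hy hz
    convert W.add_mem (W.sub_mem e1 e2) (W.neg_mem e3) using 1
    rw [hA.anticomm s y, hA.anticomm z y]
    simp only [mul_neg, add_mul]
    abel
  -- The first two terms of `key` are skew in `t`, `s` and the last is symmetric. Adding `key` to
  -- its swap leaves twice the last term.
  have h3 : (w * s * t + w * t * s) * (y * z) ∈ W := by
    apply mem_of_add_self_mem h2
    convert W.add_mem (key ht hs) (key hs ht) using 1
    rw [hA.anticomm s t]
    simp only [mul_neg, neg_mul, add_mul]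
    abel
  convert W.sub_mem (key ht hs) h3 using 1
  abel

end Filtration

/-! ### Growth of the dimensions along the filtration -/

theorem exists_sub_smul_mem {F : Type u} [Field F] {V : Type v} [AddCommGroup V] [Module F V]
    [FiniteDimensional F V] {N P : Submodule F V} (h : N ≤ P)
    (hd : Module.finrank F P ≤ Module.finrank F N + 1) {v : V} (hv : v ∈ P) (hvN : v ∉ N) {u : V}
    (hu : u ∈ P) : ∃ c : F, u - c • v ∈ N := by
  have hlt : N < N ⊔ Submodule.span F {v} :=
    lt_of_le_of_ne le_sup_left fun he => hvN (he ▸ Submodule.mem_sup_right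
      (Submodule.mem_span_singleton_self v))
  have hle : N ⊔ Submodule.span F {v} ≤ P :=
    sup_le h ((Submodule.span_singleton_le_iff_mem v P).mpr hv)
  have heq := Submodule.eq_of_le_of_finrank_le hle
    (hd.trans (Nat.succ_le_of_lt (Submodule.finrank_lt_finrank_of_lt hlt)))
  rw [← heq] at hu
  obtain ⟨a, ha, b, hb, rfl⟩ := Submodule.mem_sup.mp hu
  obtain ⟨c, rfl⟩ := Submodule.mem_span_singleton.mp hb
  exact ⟨c, by simpa using ha⟩

section Growth

variable {F : Type u} [Field F] {A : Type v} [NonUnitalNonAssocRing A] [Module F A]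
  [IsScalarTower F A A] [SMulCommClass F A A] {S : Set A}

omit [IsScalarTower F A A] in
theorem mul_mem_of_forall_prod {V : Submodule F A} {v : A}
    (h1 : ∀ g ∈ prodSpan F S 1, v * g ∈ V) (h : ∀ t ∈ S, ∀ s ∈ S, v * (t * s) ∈ V) :
    ∀ q ∈ prodSpan F S 2, v * q ∈ V := fun _ hq =>
  prodSpan_two_le (W := V.comap (LinearMap.mulLeft F v))
    (fun s hs => h1 s (subset_prodSpan hs le_rfl)) h hq

/-- If no new element appears in length `k + 1` but one does in length `k + 2`, then the dimension
grows by at least `2` in length `k`. -/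
theorem IsMalcev.finrank_add_two_le [FiniteDimensional F A] (hA : IsMalcev A) (h2 : (2 : F) ≠ 0)
    {k : ℕ} (hk : 2 ≤ k) (hgap : prodSpan F S (k + 1) ≤ prodSpan F S k)
    (hnew : ¬ prodSpan F S (k + 2) ≤ prodSpan F S k) :
    Module.finrank F (prodSpan F S (k - 1)) + 2 ≤ Module.finrank F (prodSpan F S k) := by
  by_contra! hd
  have hd' : Module.finrank F (prodSpan F S k) ≤ Module.finrank F (prodSpan F S (k - 1)) + 1 := by
    omega
  set V := prodSpan F S k with hV
  have hle : prodSpan F S (k - 1) ≤ V := prodSpan_mono (by omega)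
  have hr : ∀ u ∈ V, ∀ g ∈ prodSpan F S 1, u * g ∈ V := fun u hu g hg =>
    hgap (mul_mem_prodSpan hu hg)
  have hl : ∀ u ∈ prodSpan F S (k + 2 - 1), ∀ g ∈ prodSpan F S 1, u * g ∈ V := fun u hu =>
    hr u (hgap hu)
  have low : ∀ u ∈ prodSpan F S (k - 1), ∀ q ∈ prodSpan F S 2, u * q ∈ V := fun u hu q hq =>
    hgap (mul_mem_prodSpan_of_le (by omega) hu hq)
  have hone : prodSpan F S 1 ≤ V := prodSpan_mono (by omega)
  -- Since `V` exceeds `P_(k-1)` by at most one dimension, a single new vector `v` with `v P_2 ⊆ V`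
  -- would give `V P_2 ⊆ V`, hence `P_(k+2) ⊆ V`.
  have done : ∀ v ∈ V, v ∉ prodSpan F S (k - 1) → ¬ ∀ q ∈ prodSpan F S 2, v * q ∈ V := by
    intro v hv hvN hvq
    refine hnew (hA.prodSpan_le_of_mul_mem h2 hone hl fun u hu q hq => ?_)
    obtain ⟨c, hc⟩ := exists_sub_smul_mem hle hd' hv hvN hu
    have := V.add_mem (low _ hc q hq) (V.smul_mem c (hvq q hq))
    rwa [sub_mul, smul_mul_assoc, sub_add_cancel] at this
  by_cases hc1 : ∀ w ∈ prodSpan F S (k - 1), ∀ c ∈ prodSpan F S 1, w * c ∈ prodSpan F S (k - 1)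
  swap
  · push Not at hc1
    obtain ⟨w, hw, c, hc, hwc⟩ := hc1
    have hwcV : w * c ∈ V := mul_mem_prodSpan_of_le (by omega) hw hc
    refine done _ hwcV hwc (mul_mem_of_forall_prod (hr _ hwcV) fun a ha b hb => ?_)
    replace ha := subset_prodSpan (F := F) ha le_rfl
    replace hb := subset_prodSpan (F := F) hb le_rfl
    have swap : ∀ {x}, x ∈ prodSpan F S 1 →
        (w * c) * (x * b) + (w * x) * (c * b) ∈ V := fun hx =>
      -- This is skew-symmetry in `x` and `c`. Choosing `l` with `w * (a - l • c)` in `P_(k-1)`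
      -- settles `x = a - l • c`; the remaining multiple of `(w * c) * (c * b)` is in `V` by the
      -- case `x = c`.
      hA.mul_mul_add_swap_mem h2 hl (by omega) hw hx hb hc
    obtain ⟨l, hl'⟩ := exists_sub_smul_mem hle hd' hwcV hwc
      (mul_mem_prodSpan_of_le (by omega) hw ha : w * a ∈ V)
    have h3 := mem_of_add_self_mem h2 (swap hc)
    have h4 := swap (sub_mem ha (Submodule.smul_mem _ l hc))
    have hcb := mul_mem_prodSpan hc hb
    have h5 := low _ hl' (c * b) hcb
    rw [mul_sub w, mul_smul_comm] at h4
    have h6 := V.add_mem (V.sub_mem h4 h5) (V.smul_mem l h3)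
    rwa [add_sub_cancel_right, sub_mul, mul_sub, smul_mul_assoc, mul_smul_comm,
      sub_add_cancel] at h6
  by_cases hc2 : ∀ w ∈ prodSpan F S (k - 2), ∀ y ∈ S, ∀ z ∈ S,
      w * (y * z) ∈ prodSpan F S (k - 1)
  swap
  · push Not at hc2
    obtain ⟨w, hw, y, hy, z, hz, hp⟩ := hc2
    replace hy := subset_prodSpan (F := F) hy le_rfl
    replace hz := subset_prodSpan (F := F) hz le_rfl
    have hyz := mul_mem_prodSpan hy hz
    have hpV : w * (y * z) ∈ V := mul_mem_prodSpan_of_le (by omega) hw hyz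
    refine done _ hpV hp (mul_mem_of_forall_prod (hr _ hpV) fun t ht s hs => ?_)
    replace ht := subset_prodSpan (F := F) ht le_rfl
    replace hs := subset_prodSpan (F := F) hs le_rfl
    have hts := mul_mem_prodSpan ht hs
    -- The same argument, now with multiplications by `y * z` and `t * s`, which anticommute modulo
    -- `V`.
    obtain ⟨l, hl'⟩ := exists_sub_smul_mem hle hd' hpV hp
      (mul_mem_prodSpan_of_le (by omega) hw hts : w * (t * s) ∈ V)
    have h3 := mem_of_add_self_mem h2
      (hA.mul_prod_add_swap_mem h2 hl (by omega) hw hy hz hy hz)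
    have h4 := hA.mul_prod_add_swap_mem h2 hl (by omega) hw hy hz ht hs
    have h5 := low _ hl' (y * z) hyz
    rw [sub_mul, smul_mul_assoc] at h5
    convert V.sub_mem (V.sub_mem h4 h5) (V.smul_mem l h3) using 1
    abel
  -- No new vector arises in either form, so `P_k = P_(k-1)` and `low` already covers all of `V`.
  refine hnew (hA.prodSpan_le_of_mul_mem h2 hone hl fun u hu q hq => low u ?_ q hq)
  exact hA.prodSpan_le_of_mul_mem h2 (prodSpan_mono (by omega)) hc1
    (fun w hw => mul_mem_of_forall_prod (hc1 w (prodSpan_mono (by omega) hw)) (hc2 w hw)) hu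

theorem IsMalcev.prodSpan_stable (hA : IsMalcev A) (h2 : (2 : F) ≠ 0) {k : ℕ} (hk : 1 ≤ k)
    (h : prodSpan F S (k + 2) ≤ prodSpan F S k) (n : ℕ) : prodSpan F S n ≤ prodSpan F S k := by
  induction n using Nat.strong_induction_on with
  | _ n ih =>
    rcases le_or_gt n (k + 2) with hn | hn
    · exact (prodSpan_mono hn).trans h
    · refine hA.prodSpan_le_of_mul_mem h2 (prodSpan_mono hk) (fun u hu g hg => ?_)
        fun u hu q hq => ?_
      · exact h (mul_mem_prodSpan_of_le (by omega) (ih _ (by omega) hu) hg)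
      · exact h (mul_mem_prodSpan (ih _ (by omega) hu) hq)

theorem IsMalcev.prodSpan_eq_top_or_le_finrank [FiniteDimensional F A] (hA : IsMalcev A)
    (h2 : (2 : F) ≠ 0) (hS : ∀ a : A, ∃ i, a ∈ prodSpan F S i) (j : ℕ) :
    prodSpan F S (j + 1) = ⊤ ∨
      j + Module.finrank F (prodSpan F S 1) ≤ Module.finrank F (prodSpan F S (j + 1)) := by
  induction j using Nat.strong_induction_on with
  | _ j ih =>
    rcases j with _ | j
    · right; simp
    refine or_iff_not_imp_left.mpr fun htop => ?_
    have hne : ∀ i ≤ j, prodSpan F S (i + 1) ≠ ⊤ := fun i hi h =>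
      htop (top_le_iff.mp (h ▸ prodSpan_mono (by omega)))
    have hj := (ih j (by omega)).resolve_left (hne j le_rfl)
    by_cases hle : prodSpan F S (j + 1 + 1) ≤ prodSpan F S (j + 1)
    · have hnew : ¬ prodSpan F S (j + 1 + 2) ≤ prodSpan F S (j + 1) := fun h =>
        hne j le_rfl (eq_top_iff.mpr fun a _ =>
          have ⟨i, hi⟩ := hS a
          hA.prodSpan_stable h2 (by omega) h i hi)
      rcases j with _ | j
      -- A pause right after length 1 is final: `P_1` is then closed under multiplication.
      · exfalso
        have hr : ∀ u ∈ prodSpan F S 2, ∀ g ∈ prodSpan F S 1, u * g ∈ prodSpan F S 1 :=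
          fun u hu g hg => hle (mul_mem_prodSpan (m := 1) (hle hu) hg)
        refine hnew (hA.prodSpan_le_of_mul_mem h2 le_rfl hr fun u hu q hq => ?_)
        rw [hA.anticomm]
        exact neg_mem (hr q hq u hu)
      · have h3 := hA.finrank_add_two_le h2 (k := j + 1 + 1) (by omega) hle hnew
        have h4 := (ih j (by omega)).resolve_left (hne j (by omega))
        have h5 := Submodule.finrank_mono (prodSpan_mono (F := F) (S := S)
          (show j + 1 + 1 ≤ j + 1 + 1 + 1 by omega))
        rw [show j + 1 + 1 - 1 = j + 1 from rfl] at h3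
        omega
    · have := Submodule.finrank_lt_finrank_of_lt
        (lt_of_le_not_ge (prodSpan_mono (F := F) (S := S) (show j + 1 ≤ j + 1 + 1 by omega)) hle)
      omega

theorem IsMalcev.prodSpan_eq_top [FiniteDimensional F A] (hA : IsMalcev A) (h2 : (2 : F) ≠ 0)
    (hS : ∀ a : A, ∃ i, a ∈ prodSpan F S i) :
    prodSpan F S (Module.finrank F A - Module.finrank F (prodSpan F S 1) + 1) = ⊤ := by
  refine (hA.prodSpan_eq_top_or_le_finrank h2 hS _).elim id fun h => ?_
  refine Submodule.eq_top_of_finrank_eq (le_antisymm (Submodule.finrank_le _) ?_)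
  have := Submodule.finrank_le (prodSpan F S 1)
  omega

end Growth

/-! ### Malcev algebras with at most two generators -/

section BinaryLie

variable {F : Type u} [Field F] {A : Type v} [NonUnitalNonAssocRing A] [Module F A]

theorem jac_neg_left (x y z : A) : jac (-x) y z = -jac x y z := by
  simp only [jac, neg_mul, mul_neg]; abel

theorem jac_neg_right (x y z : A) : jac x y (-z) = -jac x y z := by
  simp only [jac, neg_mul, mul_neg]; abel

theorem jac_zero_right (x y : A) : jac x y 0 = 0 := by simp [jac]

theorem IsMalcev.jac_self_right (hA : IsMalcev A) (h2 : (2 : F) ≠ 0) (x y : A) :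
    jac x y x = 0 := by
  rw [jac_rotate, jac_rotate, hA.jac_self h2]

theorem IsMalcev.jac_mul_self_right (hA : IsMalcev A) (x y z : A) :
    jac x y (z * x) = -(jac x y z * x) := by
  rw [hA.anticomm z x, jac_neg_right, hA.jac_mul_self]

variable [IsScalarTower F A A] [SMulCommClass F A A]

variable (F) in
/-- The elements whose Jacobian with `x` and `y` vanishes. -/
def jacKer (x y : A) : Submodule F A :=
  LinearMap.ker (LinearMap.mulLeft F (x * y) +
    LinearMap.mulRight F x ∘ₗ LinearMap.mulLeft F y +
    LinearMap.mulRight F y ∘ₗ LinearMap.mulRight F x)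

theorem mem_jacKer {x y z : A} : z ∈ jacKer F x y ↔ jac x y z = 0 := Iff.rfl

theorem prodSpan_le_prodSpan {S T : Set A} (h : S ⊆ prodSpan F T 1) (n : ℕ) :
    prodSpan F S n ≤ prodSpan F T n := by
  refine prodSpan_le fun w hw => prodSpan_mono hw ?_
  clear hw
  induction w with
  | ih1 s => simpa using h s.2
  | ih2 a b iha ihb =>
    change FreeMagma.lift _ (a * b) ∈ prodSpan F T (a.length + b.length)
    rw [map_mul]
    exact mul_mem_prodSpan iha ihb

variable {S : Set A} {x y : A}

/-- A Malcev algebra with two generators is spanned by left-normed products. -/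
theorem IsMalcev.prodSpan_pair_le (hA : IsMalcev A) (h2 : (2 : F) ≠ 0) (hS : S = {x, y}) {n : ℕ}
    {W : Submodule F A} (hx : x ∈ W) (hy : y ∈ W)
    (hlx : ∀ u ∈ prodSpan F S (n - 1), u * x ∈ W) (hly : ∀ u ∈ prodSpan F S (n - 1), u * y ∈ W) :
    prodSpan F S n ≤ W := by
  have hxS : x ∈ prodSpan F S 1 := subset_prodSpan (by simp [hS]) le_rfl
  have hyS : y ∈ prodSpan F S 1 := subset_prodSpan (by simp [hS]) le_rfl
  have hxy := mul_mem_prodSpan hxS hyS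
  induction n using Nat.strong_induction_on generalizing W with
  | _ n ih =>
    have hle : prodSpan F S 1 ≤ W := prodSpan_one_le (by
      rw [hS]; rintro s (rfl | rfl) <;> assumption)
    have hl : ∀ u ∈ prodSpan F S (n - 1), ∀ g ∈ prodSpan F S 1, u * g ∈ W := by
      intro u hu g hg
      refine prodSpan_one_le (W := W.comap (LinearMap.mulLeft F u)) ?_ hg
      rw [hS]
      rintro s (rfl | rfl)
      · exact hlx u hu
      · exact hly u hu
    have key : ∀ u ∈ prodSpan F S (n - 2), u * (x * y) ∈ W := by
      rcases le_or_gt n 2 with hn | hn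
      · intro u hu
        rw [show n - 2 = 0 by omega, prodSpan_zero, Submodule.mem_bot] at hu
        rw [hu, zero_mul]
        exact zero_mem _
      · have gen : ∀ g ∈ prodSpan F S 1, g * (x * y) ∈ W := fun g hg => by
          rw [hA.anticomm]
          exact neg_mem (hl _ (prodSpan_mono (by omega) hxy) _ hg)
        have hp : n - 2 - 1 + 3 ≤ n := by omega
        -- Induction inside the preimage of `W` under right multiplication by `x * y`. It needs `(u
        -- * x) * (x * y)` and `(u * y) * (x * y)` in `W`; skew-symmetry with a repeated generator
        -- gives twice these, up to sign.
        refine ih (n - 2) (by omega) (W := W.comap (LinearMap.mulRight F (x * y)))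
          (gen x hxS) (gen y hyS) (fun u hu => ?_) (fun u hu => ?_)
        · exact show u * x * (x * y) ∈ W from
            mem_of_add_self_mem h2 (hA.mul_mul_add_swap_mem h2 hl hp hu hxS hyS hxS)
        · have := mem_of_add_self_mem h2 (hA.mul_mul_add_swap_mem h2 hl hp hu hyS hxS hyS)
          rw [hA.anticomm y x, mul_neg] at this
          exact W.neg_mem_iff.mp this
    refine hA.prodSpan_le_of_mul_mem h2 hle hl fun u hu =>
      mul_mem_of_forall_prod (hl u (prodSpan_mono (by omega) hu)) ?_
    rw [hS]
    rintro s (rfl | rfl) t (rfl | rfl)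
    · rw [hA.mul_self h2, mul_zero]; exact zero_mem _
    · exact key u hu
    · rw [hA.anticomm s t, mul_neg]; exact neg_mem (key u hu)
    · rw [hA.mul_self h2, mul_zero]; exact zero_mem _

/-- The kernel of `jac x y` contains both generators and is stable under right multiplication by
them, so left-normed products lie in it. -/
theorem IsMalcev.jac_generators (hA : IsMalcev A) (h2 : (2 : F) ≠ 0) (hS : S = {x, y})
    (hgen : ∀ a : A, ∃ i, a ∈ prodSpan F S i) (z : A) : jac x y z = 0 := by
  have h : ∀ n, prodSpan F S n ≤ jacKer F x y := by
    intro n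
    induction n with
    | zero => rw [prodSpan_zero]; exact bot_le
    | succ n ih =>
      refine hA.prodSpan_pair_le h2 hS ?_ ?_ (fun u hu => ?_) (fun u hu => ?_)
      · exact mem_jacKer.mpr (hA.jac_self_right h2 x y)
      · rw [mem_jacKer, jac_rotate, hA.jac_self h2]
      · rw [mem_jacKer, hA.jac_mul_self_right, mem_jacKer.mp (ih hu), zero_mul, neg_zero]
      · rw [mem_jacKer, hA.jac_swap, hA.jac_mul_self_right, hA.jac_swap y x u,
          mem_jacKer.mp (ih hu)]
        simp
  obtain ⟨i, hi⟩ := hgen z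
  exact h i hi

/-- One induction step in the length of `u`. For `u * y`, `IsMalcev.jac_mul` trades `jac x a (u *
y)` for Jacobians with `y` or `x * y` in place of `x`; this is why `x * y` must be carried along in
`JacVanishes`. -/
theorem IsMalcev.jac_generator_eq_zero (hA : IsMalcev A) (h2 : (2 : F) ≠ 0) (hS : S = {x, y})
    (h : ∀ z, jac x y z = 0) {p : ℕ} {a : A} (hx : ∀ u ∈ prodSpan F S (p - 1), jac x u a = 0)
    (hy : ∀ u ∈ prodSpan F S (p - 1), jac y u a = 0)
    (hxy : ∀ u ∈ prodSpan F S (p - 1), jac (x * y) u a = 0) :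
    ∀ u ∈ prodSpan F S p, jac x u a = 0 := by
  have hle : prodSpan F S p ≤ jacKer F x a := by
    have hya : jac x a y = 0 := by rw [hA.jac_swap_right, h, neg_zero]
    refine hA.prodSpan_pair_le h2 hS ?_ ?_ (fun u hu => ?_) (fun u hu => ?_)
    · exact mem_jacKer.mpr (hA.jac_self_right h2 x a)
    · exact mem_jacKer.mpr hya
    · rw [mem_jacKer, hA.jac_mul_self_right, hA.jac_swap_right, hx u hu]
      simp
    · have h3 := hA.jac_mul x a u y
      rw [← jac_rotate (x * y), hxy u hu, hya, ← jac_rotate y, hy u hu] at h3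
      simpa [mem_jacKer] using h3
  intro u hu
  rw [hA.jac_swap_right, mem_jacKer.mp (hle hu), neg_zero]

variable (F) in
/-- The Jacobians of `x`, `y`, `x * y` with products in `x` and `y` vanish in total length at most
`n`. -/
structure JacVanishes (S : Set A) (x y : A) (n : ℕ) : Prop where
  left : ∀ p q, p + q + 1 ≤ n → ∀ u ∈ prodSpan F S p, ∀ w ∈ prodSpan F S q, jac x u w = 0
  right : ∀ p q, p + q + 1 ≤ n → ∀ u ∈ prodSpan F S p, ∀ w ∈ prodSpan F S q, jac y u w = 0
  prod : ∀ p q, p + q + 2 ≤ n → ∀ u ∈ prodSpan F S p, ∀ w ∈ prodSpan F S q, jac (x * y) u w = 0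

omit [IsScalarTower F A A] [SMulCommClass F A A] in
theorem JacVanishes.symm (hA : IsMalcev A) {n : ℕ} (h : JacVanishes F S x y n) :
    JacVanishes F S y x n :=
  ⟨h.right, h.left, fun p q hpq u hu w hw => by
    rw [hA.anticomm y x, jac_neg_left, h.prod p q hpq u hu w hw, neg_zero]⟩

theorem JacVanishes.jac_mul_generator (hA : IsMalcev A) (h2 : (2 : F) ≠ 0) (hS : S = {x, y})
    (h : ∀ z, jac x y z = 0) {n p q : ℕ} (hn : JacVanishes F S x y n) (hpq : p + q + 2 ≤ n)
    {u : A} (hu : u ∈ prodSpan F S p) :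
    jac (x * y) u x = 0 ∧ ∀ w ∈ prodSpan F S q, jac (x * y) u (w * x) = 0 := by
  have hxy : x * y ∈ prodSpan F S 2 :=
    mul_mem_prodSpan (m := 1) (n := 1) (subset_prodSpan (by simp [hS]) le_rfl)
      (subset_prodSpan (by simp [hS]) le_rfl)
  -- The total length here may exceed `n`, beyond the reach of `hn.left`; shortening `u` by one
  -- letter brings it back in range.
  have lift : ∀ {r a}, a ∈ prodSpan F S r → r ≤ q + 2 →
      (∀ v ∈ prodSpan F S (p - 1), jac (x * y) v a = 0) → jac x u a = 0 := by
    intro r a ha hr hp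
    rcases p with _ | p
    · rw [prodSpan_zero, Submodule.mem_bot] at hu
      simp [hu, jac]
    · exact hA.jac_generator_eq_zero (p := p + 1) h2 hS h
        (fun v hv => hn.left p r (by omega) v hv a ha)
        (fun v hv => hn.right p r (by omega) v hv a ha) hp u hu
  constructor
  · rw [← jac_rotate, hA.jac_swap_right, lift hxy (by omega) fun v _ => hA.jac_self_right h2 _ v,
      neg_zero]
  · intro w hw
    have h3 := hA.jac_mul (x * y) u x w
    have hw' := mul_mem_prodSpan hxy hw
    rw [hn.prod p q hpq u hu w hw, hn.left p q (by omega) u hu w hw,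
      lift hw' (by omega) fun v hv => by
        rw [hA.jac_mul_self, hn.prod (p - 1) q (by omega) v hv w hw, zero_mul]] at h3
    rw [hA.anticomm w x, jac_neg_right]
    simpa using h3

theorem IsMalcev.jacVanishes (hA : IsMalcev A) (h2 : (2 : F) ≠ 0) (hS : S = {x, y})
    (hgen : ∀ a : A, ∃ i, a ∈ prodSpan F S i) (n : ℕ) : JacVanishes F S x y n := by
  have hS' : S = {y, x} := hS.trans (Set.pair_comm x y)
  have hx := hA.jac_generators h2 hS hgen
  have hy := hA.jac_generators h2 hS' hgen
  induction n with
  | zero => exact ⟨by omega, by omega, by omega⟩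
  | succ n ih =>
    -- The case of `x * y` comes first, since the step for `x` and `y` uses it at the new length.
    have prod : ∀ p q, p + q + 2 ≤ n + 1 → ∀ u ∈ prodSpan F S p, ∀ w ∈ prodSpan F S q,
        jac (x * y) u w = 0 := by
      intro p q hpq u hu w hw
      rcases q with _ | q
      · rw [prodSpan_zero, Submodule.mem_bot] at hw
        rw [hw, jac_zero_right]
      · obtain ⟨h3, h4⟩ := ih.jac_mul_generator hA h2 hS hx (q := q) (by omega) hu
        obtain ⟨h5, h6⟩ := (ih.symm hA).jac_mul_generator hA h2 hS' hy (q := q) (by omega) hu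
        simp only [hA.anticomm y x, jac_neg_left, neg_eq_zero] at h5 h6
        have hle : prodSpan F S (q + 1) ≤ jacKer F (x * y) u :=
          hA.prodSpan_pair_le h2 hS (mem_jacKer.mpr h3) (mem_jacKer.mpr h5)
            (fun w hw => mem_jacKer.mpr (h4 w hw)) (fun w hw => mem_jacKer.mpr (h6 w hw))
        exact mem_jacKer.mp (hle hw)
    have one : ∀ {x y : A}, S = {x, y} → (∀ z, jac x y z = 0) → JacVanishes F S x y n →
        (∀ p q, p + q + 2 ≤ n + 1 → ∀ u ∈ prodSpan F S p, ∀ w ∈ prodSpan F S q,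
          jac (x * y) u w = 0) →
        ∀ p q, p + q + 1 ≤ n + 1 → ∀ u ∈ prodSpan F S p, ∀ w ∈ prodSpan F S q,
          jac x u w = 0 := by
      intro x y hS hx ih prod p q hpq u hu w hw
      rcases p with _ | p
      · rw [prodSpan_zero, Submodule.mem_bot] at hu
        simp [hu, jac]
      · exact hA.jac_generator_eq_zero (p := p + 1) h2 hS hx
          (fun v hv => ih.left p q (by omega) v hv w hw)
          (fun v hv => ih.right p q (by omega) v hv w hw)
          (fun v hv => prod p q (by omega) v hv w hw) u hu
    refine ⟨one hS hx ih prod, one hS' hy (ih.symm hA) fun p q hpq u hu w hw => ?_, prod⟩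
    rw [hA.anticomm y x, jac_neg_left, prod p q hpq u hu w hw, neg_zero]

/-- A Malcev algebra generated by two elements is a Lie algebra. -/
theorem IsMalcev.isLie_of_pair (hA : IsMalcev A) (h2 : (2 : F) ≠ 0) (hS : S = {x, y})
    (hgen : ∀ a : A, ∃ i, a ∈ prodSpan F S i) : IsLie A := by
  have hx : ∀ a b, jac x a b = 0 := fun a b => by
    obtain ⟨i, hi⟩ := hgen a
    obtain ⟨j, hj⟩ := hgen b
    exact (hA.jacVanishes h2 hS hgen (i + j + 1)).left i j le_rfl a hi b hj
  have hy : ∀ a b, jac y a b = 0 := fun a b => by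
    obtain ⟨i, hi⟩ := hgen a
    obtain ⟨j, hj⟩ := hgen b
    exact (hA.jacVanishes h2 hS hgen (i + j + 1)).right i j le_rfl a hi b hj
  have hw : ∀ (w : FreeMagma S) (a b : A),
      jac (FreeMagma.lift (Subtype.val : S → A) w) a b = 0 := by
    intro w
    induction w with
    | ih1 s =>
      have hs : (s : A) = x ∨ (s : A) = y := hS.subset s.2
      intro a b
      change jac (s : A) a b = 0
      rcases hs with hs | hs <;> rw [hs]
      · exact hx a b
      · exact hy a b
    | ih2 w₁ w₂ ih₁ ih₂ =>
      intro a b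
      rw [map_mul]
      -- Elements whose Jacobians all vanish are closed under products: in this identity every other
      -- term has `w₁` or `w₂` as an argument of a Jacobian.
      have h3 := hA.jac_mul a b (FreeMagma.lift (Subtype.val : S → A) w₁)
        (FreeMagma.lift (Subtype.val : S → A) w₂)
      rw [ih₁, ih₁, ← jac_rotate (FreeMagma.lift _ w₂), ih₂] at h3
      rw [jac_rotate]
      simpa using h3
  refine hA.isLie_of_jac h2 fun a b c => ?_
  obtain ⟨i, hi⟩ := hgen c
  refine prodSpan_le (W := jacKer F a b) (fun w _ => ?_) hi
  rw [mem_jacKer, ← jac_rotate]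
  exact hw w a b

theorem exists_le_span_pair {V : Type v} [AddCommGroup V] [Module F V] [FiniteDimensional F V]
    (P : Submodule F V) (h : Module.finrank F P ≤ 2) :
    ∃ x y : V, P ≤ Submodule.span F {x, y} := by
  let b := Module.finBasis F P
  have hb : P = Submodule.span F (Set.range fun i => (b i : V)) := by
    have := congrArg (Submodule.map P.subtype) b.span_eq
    rw [Submodule.map_span, Submodule.map_top, Submodule.range_subtype, ← Set.range_comp] at this
    exact this.symm
  refine ⟨if h : 0 < Module.finrank F P then b ⟨0, h⟩ else 0,
    if h : 1 < Module.finrank F P then b ⟨1, h⟩ else 0, ?_⟩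
  refine hb.le.trans (Submodule.span_mono ?_)
  rintro _ ⟨⟨i, hi⟩, rfl⟩
  have h3 : i = 0 ∨ i = 1 := by omega
  rcases h3 with rfl | rfl
  · left; rw [dif_pos hi]
  · right; simp only [Set.mem_singleton_iff]; rw [dif_pos hi]

theorem IsMalcev.isLie_of_finrank_le_two [FiniteDimensional F A] (hA : IsMalcev A)
    (h2 : (2 : F) ≠ 0) (hgen : ∀ a : A, ∃ i, a ∈ prodSpan F S i)
    (h : Module.finrank F (prodSpan F S 1) ≤ 2) : IsLie A := by
  obtain ⟨x, y, hxy⟩ := exists_le_span_pair _ h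
  have hle : Submodule.span F {x, y} ≤ prodSpan F {x, y} 1 :=
    Submodule.span_le.mpr fun s hs => subset_prodSpan hs le_rfl
  refine hA.isLie_of_pair h2 rfl (F := F) (x := x) (y := y) fun a => ?_
  obtain ⟨i, hi⟩ := hgen a
  exact ⟨i, prodSpan_le_prodSpan (fun s hs => hle (hxy (subset_prodSpan hs le_rfl))) i hi⟩

theorem IsMalcev.finrank_le_of_finrank_le_one [FiniteDimensional F A] (hA : IsMalcev A)
    (h2 : (2 : F) ≠ 0) (hgen : ∀ a : A, ∃ i, a ∈ prodSpan F S i)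
    (h : Module.finrank F (prodSpan F S 1) ≤ 1) :
    Module.finrank F A ≤ Module.finrank F (prodSpan F S 1) := by
  obtain ⟨g, hg⟩ := finrank_le_one_iff.mp h
  have hmul : ∀ a ∈ prodSpan F S 1, ∀ b ∈ prodSpan F S 1, a * b = 0 := by
    intro a ha b hb
    obtain ⟨c, hc⟩ := hg ⟨a, ha⟩
    obtain ⟨d, hd⟩ := hg ⟨b, hb⟩
    obtain rfl : c • (g : A) = a := congrArg Subtype.val hc
    obtain rfl : d • (g : A) = b := congrArg Subtype.val hd
    rw [smul_mul_smul_comm, hA.mul_self h2, smul_zero]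
  have htop : prodSpan F S 1 = ⊤ := by
    refine eq_top_iff.mpr fun a _ => ?_
    obtain ⟨i, hi⟩ := hgen a
    refine prodSpan_le (fun w hw => ?_) hi
    clear hw
    induction w with
    | ih1 s => exact subset_prodSpan s.2 le_rfl
    | ih2 w₁ w₂ ih₁ ih₂ =>
      change FreeMagma.lift _ (w₁ * w₂) ∈ _
      rw [map_mul, hmul _ ih₁ _ ih₂]
      exact zero_mem _
  rw [htop, finrank_top]

end BinaryLie

/-! ### Length bounds -/

section Length

variable {F : Type u} [Field F] {A : Type v} [NonUnitalNonAssocRing A] [Module F A]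

theorem IsMalcev.wordSpan_eq [Nontrivial A] (hA : IsMalcev A) (h2 : (2 : F) ≠ 0) (S : Set A)
    (n : ℕ) : wordSpan F S n = prodSpan F S n := by
  have h : {e : A | IsIdentity e} = ∅ := by
    refine Set.eq_empty_of_forall_notMem fun e he => ?_
    -- Squares vanish, so an identity element would be zero; words of length 0 contribute nothing
    -- when `A` is nontrivial.
    have h0 : e = 0 := by rw [← (he e).1, hA.mul_self h2]
    obtain ⟨x, hx⟩ := exists_ne (0 : A)
    exact hx (by rw [← (he x).1, h0, zero_mul])
  rw [wordSpan, words, h, Set.union_empty, prodSpan]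

theorem length_le {k : ℕ} (h : ∀ S : Set A, Generates F S → ∃ j ≤ k, wordSpan F S j = ⊤) :
    length F A ≤ k := by
  refine iSup₂_le fun S hS => ?_
  obtain ⟨j, hj, htop⟩ := h S hS.2
  exact (iInf₂_le j htop).trans (by exact_mod_cast hj)

variable [IsScalarTower F A A] [SMulCommClass F A A] [FiniteDimensional F A]

theorem IsMalcev.length_le_sub [Nontrivial A] (hA : IsMalcev A) (h2 : (2 : F) ≠ 0) {m : ℕ}
    (h : ∀ S : Set A, (∀ a : A, ∃ i, a ∈ prodSpan F S i) →
      m ≤ Module.finrank F (prodSpan F S 1)) :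
    length F A ≤ (Module.finrank F A - m + 1 : ℕ) := by
  refine length_le fun S hS => ?_
  have hgen : ∀ a : A, ∃ i, a ∈ prodSpan F S i := fun a => by
    simpa only [hA.wordSpan_eq h2] using hS a
  have := h S hgen
  refine ⟨_, ?_, (hA.wordSpan_eq h2 S _).trans (hA.prodSpan_eq_top h2 hgen)⟩
  omega

theorem IsMalcev.length_add_one_le (hA : IsMalcev A) (h2 : (2 : F) ≠ 0)
    (hd : 2 ≤ Module.finrank F A) : length F A + 1 ≤ (Module.finrank F A : ℕ∞) := by
  have : Nontrivial A := Module.nontrivial_of_finrank_pos (R := F) (by omega)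
  have h := hA.length_le_sub h2 (m := 2) fun S hgen => by
    by_contra! hlt
    have := hA.finrank_le_of_finrank_le_one h2 hgen (by omega)
    omega
  refine (add_le_add_left h 1).trans ?_
  exact_mod_cast (by omega : Module.finrank F A - 2 + 1 + 1 ≤ Module.finrank F A)

theorem IsMalcev.length_add_two_le (hA : IsMalcev A) (h2 : (2 : F) ≠ 0) (hL : ¬ IsLie A) :
    length F A + 2 ≤ (Module.finrank F A : ℕ∞) := by
  have hm : ∀ S : Set A, (∀ a : A, ∃ i, a ∈ prodSpan F S i) →
      3 ≤ Module.finrank F (prodSpan F S 1) := fun S hgen => by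
    by_contra! hlt
    exact hL (hA.isLie_of_finrank_le_two h2 hgen (by omega))
  -- The whole of `A` is a generating set, which turns the bound on `P_1` into one on `A`; the
  -- natural subtraction `d - 3` is then exact.
  have hd : 3 ≤ Module.finrank F A :=
    (hm Set.univ fun a => ⟨1, subset_prodSpan (Set.mem_univ a) le_rfl⟩).trans
      (Submodule.finrank_le _)
  have : Nontrivial A := Module.nontrivial_of_finrank_pos (R := F) (by omega)
  refine (add_le_add_left (hA.length_le_sub h2 hm) 2).trans ?_
  exact_mod_cast (by omega : Module.finrank F A - 3 + 1 + 2 ≤ Module.finrank F A)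

theorem IsMalcev.length_le_finrank (hA : IsMalcev A) (h2 : (2 : F) ≠ 0) :
    length F A ≤ (Module.finrank F A : ℕ∞) := by
  cases subsingleton_or_nontrivial A with
  | inl _ =>
    exact length_le fun S _ => ⟨0, Nat.zero_le _, Subsingleton.elim _ _⟩
  | inr _ =>
    have hd : 0 < Module.finrank F A := Module.finrank_pos
    refine (hA.length_le_sub h2 (m := 1) fun S hgen => ?_).trans ?_
    · by_contra! hlt
      have := hA.finrank_le_of_finrank_le_one h2 hgen (by omega)
      omega
    · exact_mod_cast (by omega : Module.finrank F A - 1 + 1 ≤ Module.finrank F A)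

end Length
end NonassocLength

theorem mainTheorem1 :
    (∀ (F : Type u) [Field F] (A : Type v) [NonUnitalNonAssocRing A] [Module F A]
      [IsScalarTower F A A] [SMulCommClass F A A] [FiniteDimensional F A],
      ringChar F ≠ 2 → NonassocLength.IsMalcev A →
        (2 ≤ Module.finrank F A →
          NonassocLength.length F A + 1 ≤ (Module.finrank F A : ℕ∞)) ∧
        (¬ NonassocLength.IsLie A →
          NonassocLength.length F A + 2 ≤ (Module.finrank F A : ℕ∞))) ∧
    NonassocLength.HasSlowlyGrowingLength.{u, v} NonassocLength.MalcevClass.{u, v} := by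
  refine ⟨?_, ?_⟩
  · intro F _ A _ _ _ _ _ hF hA
    have h2 := Ring.two_ne_zero hF
    exact ⟨hA.length_add_one_le h2, hA.length_add_two_le h2⟩
  · intro F _ A _ _ _ _ _ h
    exact h.2.length_le_finrank (Ring.two_ne_zero h.1)
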